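/- A \emph{link diagram} $D$ in $\mathbb S^2$ consists of finitely many closed curves in the oriented sphere whose only singularities are finitely many transverse double points (\emph{crossings}), at each of which one branch is marked as the over-arc and the other as the under-arc. The diagram may be disconnected, and curves without crossings are allowed. At a crossing $c$ the over-arc, swept counterclockwise, passes two opposite corners before it reaches the under-arc; these two corners are called \emph{dotted}, the other two \emph{undotted}. To \emph{smooth} $c$ is to replace it by two disjoint arcs in such a way that the two dotted corners are merged. A \emph{state} $S$ of $D$ is obtained by smoothing the crossings in some subset (possibly empty) of the set of crossings. The components of $S$ are the closed curves obtained by travelling along it (going straight through the remaining crossings). Two components (possibly equal) of $S$ \emph{cross} or \emph{kiss} if they contain the two arcs that are present in $S$ at some crossing of $D$ (crossing arcs if it was not smoothed, parallel arcs if it was). The state is \emph{colorable} if no component crosses or kisses itself, and a colorable state is \emph{$3$-colorable} if its components can be colored with three colors so that any two components that cross or kiss have different colors. The diagram $D$ is \emph{semi-reduced} if there is no crossing $c$ with a simple closed curve that meets $D$ only in $c$ and passes there from one undotted corner to the opposite undotted one; equivalently, at every crossing the two undotted corners belong to different regions of $D$. \textbf{Corollary.} The following two statements are equivalent. (1) (The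 Four Color Theorem) For every finite graph drawn on $\mathbb S^2$ (equivalently, in the plane), loops, multiple edges, bridges and several connected components being allowed, the regions of its complement can be colored with four colors so that any two different regions with a common border edge have different colors. (2) Every semi-reduced link diagram in $\mathbb S^2$ has a $3$-colorable state. -/

import Mathlib

/-- A finite graph (loops and multiple edges allowed, no isolated vertices) drawn on an oriented
surface, recorded combinatorially. A dart is an edge together with a choice of one of its two ends;
vertices are the cycles of `next`, edges are the pairs `{d, opp d}`. The regions are the connected
components of the complement of the graph. The graph need not be connected, so that the boundary of
a region may consist of several closed walks. -/
structure SurfaceGraph where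
  Dart : Type
  Region : Type
  finite_dart : Finite Dart
  finite_region : Finite Region
  /-- The counterclockwise next dart around the vertex from which the dart starts. -/
  next : Equiv.Perm Dart
  /-- The same edge, seen from its other end. -/
  opp : Dart → Dart
  opp_opp : ∀ d, opp (opp d) = d
  opp_ne : ∀ d, opp d ≠ d
  /-- The region that has the corner between `d` and `next d`, that is, the region to the left of
  `d` when `d` is traversed away from its vertex; so `region (opp d)` is the region to the right
  of `d`. -/
  region : Dart → Region
  /-- The corner between `d` and `next d` lies to the left of `d` and to the right of `next d`. -/
  region_opp_next : ∀ d, region (opp (next d)) = region d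

namespace SurfaceGraph

def Vertex (G : SurfaceGraph) : Type := Quot fun d d' : G.Dart => d' = G.next d

def Edge (G : SurfaceGraph) : Type := Quot fun d d' : G.Dart => d' = G.opp d

/-- The connected components of the graph. -/
def Component (G : SurfaceGraph) : Type :=
  Quot fun d d' : G.Dart => d' = G.next d ∨ d' = G.opp d

/-- The surface is the sphere: it is connected (any region can be reached from any other one by
crossing edges), and Euler's formula `V - E + F = 1 + C` for a graph with `C` components holds.
On any other connected closed oriented surface `V - E + F` is smaller than `1 + C`. -/
structure IsSpherical (G : SurfaceGraph) : Prop where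
  connected : ∀ r s : G.Region,
    Relation.EqvGen (fun a b => ∃ d, a = G.region d ∧ b = G.region (G.opp d)) r s
  euler : Nat.card G.Vertex + Nat.card G.Region = Nat.card G.Edge + Nat.card G.Component + 1

/-- Two different regions are adjacent if they have a common border edge. -/
def Adjacent (G : SurfaceGraph) (r s : G.Region) : Prop :=
  r ≠ s ∧ ∃ d, r = G.region d ∧ s = G.region (G.opp d)

end SurfaceGraph

/-- The regions of every map on the sphere (equivalently, in the plane, where the unbounded region
is coloured as well) can be coloured with four colours so that adjacent regions get different
colours. -/
def FourColorTheorem : Prop :=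
  ∀ G : SurfaceGraph, G.IsSpherical →
    ∃ color : G.Region → Fin 4, ∀ r s, G.Adjacent r s → color r ≠ color s

/-- A link diagram on an oriented surface. At each crossing `c` there are four ends `(c, i)`,
`i : ZMod 4`, in counterclockwise order; the under-arc joins the ends `0` and `2`, the over-arc
joins the ends `1` and `3`. Outside the crossings the ends are joined in pairs by arcs. In addition
there are simple closed curves without crossings (`Circle`), each with two sides. -/
structure LinkDiagram where
  Crossing : Type
  Circle : Type
  Region : Type
  finite_crossing : Finite Crossing
  finite_circle : Finite Circle
  finite_region : Finite Region
  /-- The other end of the arc of the diagram that starts at the given end. -/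
  arc : Crossing × ZMod 4 → Crossing × ZMod 4
  arc_arc : ∀ x, arc (arc x) = x
  arc_ne : ∀ x, arc x ≠ x
  /-- The region that has the corner between the ends `(c, i)` and `(c, i + 1)`. -/
  corner : Crossing × ZMod 4 → Region
  /-- The corner between the ends `i` and `i + 1` is adjacent to the arc starting at `i + 1`, and
  is on the left of this arc when the arc is traversed towards `c`. -/
  corner_arc : ∀ c i, corner (arc (c, i + 1)) = corner (c, i)
  /-- The two regions on the two sides of a circle. -/
  side : Circle × Bool → Region

namespace LinkDiagram

/-- The graph on the surface underlying a link diagram: crossings become vertices of degree four,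
and each circle without crossings gets one vertex of degree two. -/
def shadow (D : LinkDiagram) : SurfaceGraph where
  Dart := (D.Crossing × ZMod 4) ⊕ (D.Circle × Bool)
  Region := D.Region
  finite_dart := by
    have := D.finite_crossing
    have := D.finite_circle
    have : Finite (ZMod 4) := inferInstanceAs (Finite (Fin 4))
    infer_instance
  finite_region := D.finite_region
  next := Equiv.sumCongr
    (Equiv.prodCongr (Equiv.refl _) (Equiv.addRight 1))
    (Equiv.prodCongr (Equiv.refl _) Equiv.boolNot)
  opp := Sum.map D.arc (fun x => (x.1, !x.2))
  opp_opp := by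
    rintro (x | ⟨k, b⟩)
    · simp [D.arc_arc]
    · simp
  opp_ne := by
    rintro (x | ⟨k, b⟩)
    · simpa using D.arc_ne x
    · simp
  region := Sum.elim D.corner D.side
  region_opp_next := by
    rintro (⟨c, i⟩ | ⟨k, b⟩)
    · simpa using D.corner_arc c i
    · simp

/-- The diagram is a link diagram in the sphere. -/
def IsSpherical (D : LinkDiagram) : Prop := D.shadow.IsSpherical

/-- When the over-arc of a crossing sweeps counterclockwise, it passes the corners between the ends
`1, 2` and between the ends `3, 0` (the dotted corners) before it reaches the under-arc. A diagram
is semi-reduced if there is no crossing `c` at which two boxes are joined, one of them containing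
the ends `1, 2` and the other one the ends `3, 0`; that is, no simple closed curve meets the diagram
just in `c` and passes there from one undotted corner to the opposite one. -/
def IsSemiReduced (D : LinkDiagram) : Prop :=
  ∀ c : D.Crossing, D.corner (c, 0) ≠ D.corner (c, 2)

/-- A state is given by the set of the crossings that are smoothed. -/
abbrev State (D : LinkDiagram) : Type := Set D.Crossing

open Classical in
/-- How the ends at a crossing are joined in a state. An unsmoothed crossing joins opposite ends.
Smoothing merges the two dotted corners, so it joins `0` with `1` and `2` with `3`, which is
`i ↦ 1 - i` in `ZMod 4`. -/
noncomputable def turn (D : LinkDiagram) (S : D.State) (x : D.Crossing × ZMod 4) :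
    D.Crossing × ZMod 4 :=
  if x.1 ∈ S then (x.1, 1 - x.2) else (x.1, x.2 + 2)

/-- The link components of a state: the closed curves obtained by travelling along arcs and through
crossings and smoothings, and the circles without crossings. -/
def StateComponent (D : LinkDiagram) (S : D.State) : Type :=
  (Quot fun x y : D.Crossing × ZMod 4 => y = D.arc x ∨ y = D.turn S x) ⊕ D.Circle

/-- The component of a state through a given end. -/
def componentOf (D : LinkDiagram) (S : D.State) (x : D.Crossing × ZMod 4) : D.StateComponent S :=
  Sum.inl (Quot.mk _ x)

/-- Two components (possibly equal) cross or kiss: they contain the two different arcs into which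
the state resolves some crossing, one through the end `(c, i)` and the other through `(c, j)`. -/
def CrossOrKiss (D : LinkDiagram) (S : D.State) (K L : D.StateComponent S) : Prop :=
  ∃ (c : D.Crossing) (i j : ZMod 4), (c, j) ≠ (c, i) ∧ (c, j) ≠ D.turn S (c, i) ∧
    K = D.componentOf S (c, i) ∧ L = D.componentOf S (c, j)

/-- No component crosses or kisses itself. -/
def IsColorable (D : LinkDiagram) (S : D.State) : Prop :=
  ∀ K : D.StateComponent S, ¬ D.CrossOrKiss S K K

/-- An `n`-colouring of a state: components that cross or kiss get different colours. -/
def IsColoring (D : LinkDiagram) (S : D.State) (n : ℕ) (color : D.StateComponent S → Fin n) :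
    Prop :=
  ∀ K L : D.StateComponent S, D.CrossOrKiss S K L → color K ≠ color L

/-- A colorable state that has an `n`-colouring. -/
def IsNColorable (D : LinkDiagram) (S : D.State) (n : ℕ) : Prop :=
  D.IsColorable S ∧ ∃ color : D.StateComponent S → Fin n, D.IsColoring S n color

end LinkDiagram

/-! ### Mod 2 cycles and boundaries of a map on the sphere. -/

namespace SurfaceGraph

variable (G : SurfaceGraph)

/-! Read four colours as the elements of the Klein group and three colours as its nonzero elements.
The common tool is that on the sphere every mod 2 cycle is the boundary of a set of regions
(`exists_regionCoboundary_eq`), proved by a dimension count with Euler's formula.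

From (1) to (2): replace each crossing by a bar whose two sides are the undotted corners. `barGraph`
has the same regions and is again spherical, and a four-colouring of it separates the undotted
corners as well as the two sides of each arc, which are distinct regions because the diagram has a
checkerboard colouring. Colour each arc by the difference of the colours on its sides. The four
differences around a crossing sum to zero, so they agree in pairs. The two undotted corners having
different colours excludes one of the three pairings, and the other two are realised by smoothing
the crossing or by leaving it (`exists_state_of_region_coloring`).

From (2) to (1): in the medial diagram, let the undotted corners at an edge be the two regions along
it, or its two end vertices if those regions coincide; the diagram is then semi-reduced. In a
3-colored state, the union of the components of one color is a mod 2 cycle, hence bounds a set of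
regions. Two such sets give a four-colouring that separates the undotted corners
(`exists_region_coloring`); its restriction to the regions of the graph is the one sought. -/

def vertexOf (d : G.Dart) : G.Vertex := Quot.mk _ d

def edgeOf (d : G.Dart) : G.Edge := Quot.mk _ d

def componentOf (d : G.Dart) : G.Component := Quot.mk _ d

theorem vertexOf_next (d : G.Dart) : G.vertexOf (G.next d) = G.vertexOf d :=
  (Quot.sound (r := fun d d' : G.Dart => d' = G.next d) rfl).symm

theorem edgeOf_opp (d : G.Dart) : G.edgeOf (G.opp d) = G.edgeOf d :=
  (Quot.sound (r := fun d d' : G.Dart => d' = G.opp d) rfl).symm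

theorem componentOf_next (d : G.Dart) : G.componentOf (G.next d) = G.componentOf d :=
  (Quot.sound (r := fun d d' : G.Dart => d' = G.next d ∨ d' = G.opp d) (Or.inl rfl)).symm

theorem componentOf_opp (d : G.Dart) : G.componentOf (G.opp d) = G.componentOf d :=
  (Quot.sound (r := fun d d' : G.Dart => d' = G.next d ∨ d' = G.opp d) (Or.inr rfl)).symm

theorem edgeOf_eq_iff {d d' : G.Dart} : G.edgeOf d' = G.edgeOf d ↔ d' = d ∨ d' = G.opp d := by
  constructor
  · intro h
    have h' := Quot.eqvGen_exact h
    clear h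
    induction h' with
    | rel x y h => right; rw [h, G.opp_opp]
    | refl => exact Or.inl rfl
    | symm x y _ ih =>
      rcases ih with rfl | rfl
      · exact Or.inl rfl
      · right; rw [G.opp_opp]
    | trans x y z _ _ h1 h2 =>
      rcases h1 with rfl | rfl
      · exact h2
      · rcases h2 with rfl | rfl
        · exact Or.inr rfl
        · left; rw [G.opp_opp]
  · rintro (rfl | rfl)
    · rfl
    · exact G.edgeOf_opp d

instance : Finite G.Dart := G.finite_dart
instance : Finite G.Region := G.finite_region
instance : Finite G.Vertex := inferInstanceAs (Finite (Quot _))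
instance : Finite G.Edge := inferInstanceAs (Finite (Quot _))
instance : Finite G.Component := inferInstanceAs (Finite (Quot _))

theorem edge_sum {A : Type*} [AddCommMonoid A] [Fintype G.Dart] [DecidableEq G.Edge]
    (h : G.Dart → A) (d : G.Dart) :
    ∑ x with G.edgeOf x = G.edgeOf d, h x = h d + h (G.opp d) := by
  classical
  have : (Finset.univ.filter fun x => G.edgeOf x = G.edgeOf d) = {d, G.opp d} := by
    ext x
    simp [G.edgeOf_eq_iff]
  rw [this, Finset.sum_pair (G.opp_ne d).symm]

theorem card_dart : Nat.card G.Dart = 2 * Nat.card G.Edge := by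
  classical
  have := Fintype.ofFinite G.Dart
  have := Fintype.ofFinite G.Edge
  rw [Nat.card_eq_fintype_card, Nat.card_eq_fintype_card, ← Finset.card_univ,
    Finset.card_eq_sum_card_fiberwise (f := G.edgeOf) (t := Finset.univ) (by simp)]
  have : ∀ e : G.Edge, (Finset.univ.filter fun x => G.edgeOf x = e).card = 2 := by
    rintro ⟨d⟩
    have := G.edge_sum (fun _ => 1) d
    rw [Finset.card_eq_sum_ones]
    exact this
  simp [this, mul_comm]

/-- The coboundary of a function on the vertices. -/
noncomputable def vertexCoboundary [Fintype G.Dart] :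
    (G.Vertex → ZMod 2) →ₗ[ZMod 2] (G.Edge → ZMod 2) := by
  classical
  exact
  { toFun := fun g e => ∑ d with G.edgeOf d = e, g (G.vertexOf d)
    map_add' := by
      intro f g; ext e; simp [Finset.sum_add_distrib]
    map_smul' := by
      intro c g; ext e; simp [Finset.mul_sum] }

theorem vertexCoboundary_edgeOf [Fintype G.Dart] (g : G.Vertex → ZMod 2) (d : G.Dart) :
    G.vertexCoboundary g (G.edgeOf d) = g (G.vertexOf d) + g (G.vertexOf (G.opp d)) := by
  classical
  exact G.edge_sum (fun d => g (G.vertexOf d)) d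

/-- Grouping darts by edges exhibits the sum over darts as a pairing with a coboundary, so the cycle
condition says that `φ` is orthogonal to all vertex coboundaries. -/
theorem sum_mul_vertexCoboundary [Fintype G.Dart] [Fintype G.Edge] (g : G.Vertex → ZMod 2)
    (φ : G.Edge → ZMod 2) :
    ∑ e, φ e * G.vertexCoboundary g e = ∑ d, φ (G.edgeOf d) * g (G.vertexOf d) := by
  classical
  rw [← Finset.sum_fiberwise Finset.univ G.edgeOf]
  refine Finset.sum_congr rfl fun e _ => ?_
  change φ e * ∑ d with G.edgeOf d = e, g (G.vertexOf d) = _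
  rw [Finset.mul_sum]
  refine Finset.sum_congr rfl fun d hd => ?_
  rw [(Finset.mem_filter.1 hd).2]

/-- The coboundary of a function on the regions. -/
def regionCoboundary : (G.Region → ZMod 2) →ₗ[ZMod 2] (G.Edge → ZMod 2) where
  toFun f := Quot.lift (fun d => f (G.region d) + f (G.region (G.opp d))) (by
    rintro a _ rfl
    rw [G.opp_opp, add_comm])
  map_add' f g := by
    ext ⟨d⟩
    exact add_add_add_comm _ _ _ _
  map_smul' c f := by
    funext e
    induction e using Quot.ind with | mk d =>
    change c * f (G.region d) + c * f (G.region (G.opp d)) =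
      c * (f (G.region d) + f (G.region (G.opp d)))
    ring

theorem regionCoboundary_edgeOf (f : G.Region → ZMod 2) (d : G.Dart) :
    G.regionCoboundary f (G.edgeOf d) = f (G.region d) + f (G.region (G.opp d)) := rfl

/-- Boundaries are cycles: around a vertex, the right side of each dart is the left side of the
preceding one, so every corner contributes twice. -/
theorem sum_regionCoboundary_mul [Fintype G.Dart] (f : G.Region → ZMod 2)
    (g : G.Vertex → ZMod 2) :
    ∑ d, G.regionCoboundary f (G.edgeOf d) * g (G.vertexOf d) = 0 := by
  simp only [regionCoboundary_edgeOf, add_mul, Finset.sum_add_distrib]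
  have : ∑ d, f (G.region (G.opp d)) * g (G.vertexOf d) =
      ∑ d, f (G.region d) * g (G.vertexOf d) := by
    rw [← Equiv.sum_comp G.next]
    simp only [G.region_opp_next, G.vertexOf_next]
  rw [this]
  exact CharTwo.add_self_eq_zero _

/-- A function killed by the coboundary agrees at the two ends of each edge, hence is pulled back
from the set of components. -/
theorem finrank_ker_vertexCoboundary_le [Fintype G.Dart] :
    Module.finrank (ZMod 2) (LinearMap.ker G.vertexCoboundary) ≤ Nat.card G.Component := by
  have := Fintype.ofFinite G.Component
  have := Fintype.ofFinite G.Vertex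
  let L : (G.Component → ZMod 2) →ₗ[ZMod 2] (G.Vertex → ZMod 2) :=
    LinearMap.funLeft (ZMod 2) (ZMod 2)
      (Quot.lift G.componentOf (by rintro a _ rfl; exact (G.componentOf_next a).symm))
  have hle : LinearMap.ker G.vertexCoboundary ≤ LinearMap.range L := by
    intro g hg
    have hg' : ∀ d, g (G.vertexOf d) = g (G.vertexOf (G.opp d)) := by
      intro d
      have := congrFun hg (G.edgeOf d)
      rw [vertexCoboundary_edgeOf] at this
      exact CharTwo.add_eq_zero.1 this
    refine ⟨Quot.lift (fun d => g (G.vertexOf d)) ?_, ?_⟩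
    · rintro a _ (rfl | rfl)
      · rw [G.vertexOf_next]
      · exact hg' a
    · ext ⟨d⟩
      rfl
  calc _ ≤ Module.finrank (ZMod 2) (LinearMap.range L) := Submodule.finrank_mono hle
    _ ≤ Module.finrank (ZMod 2) (G.Component → ZMod 2) := LinearMap.finrank_range_le L
    _ = Nat.card G.Component := by simp

variable {G}

theorem IsSpherical.finrank_ker_regionCoboundary_le (hG : G.IsSpherical) :
    Module.finrank (ZMod 2) (LinearMap.ker G.regionCoboundary) ≤ 1 := by
  have := Fintype.ofFinite G.Region
  have hle : LinearMap.ker G.regionCoboundary ≤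
      Submodule.span (ZMod 2) {fun _ : G.Region => (1 : ZMod 2)} := by
    intro f hf
    have hf' : ∀ r s, f r = f s := by
      intro r s
      induction hG.connected r s with
      | rel r s h =>
        obtain ⟨d, rfl, rfl⟩ := h
        have := congrFun hf (G.edgeOf d)
        rw [regionCoboundary_edgeOf] at this
        exact CharTwo.add_eq_zero.1 this
      | refl => rfl
      | symm _ _ _ ih => exact ih.symm
      | trans _ _ _ _ _ h1 h2 => exact h1.trans h2
    rw [Submodule.mem_span_singleton]
    rcases isEmpty_or_nonempty G.Region with h | ⟨⟨r⟩⟩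
    · exact ⟨0, Subsingleton.elim _ _⟩
    · refine ⟨f r, ?_⟩
      ext s
      simpa using hf' r s
  refine (Submodule.finrank_mono hle).trans ?_
  exact (finrank_span_le_card _).trans (by simp)

/-- On the sphere, every cycle modulo two is the boundary of a set of regions. -/
theorem IsSpherical.exists_regionCoboundary_eq (hG : G.IsSpherical) [Fintype G.Dart]
    (φ : G.Edge → ZMod 2)
    (hφ : ∀ g : G.Vertex → ZMod 2, ∑ d, φ (G.edgeOf d) * g (G.vertexOf d) = 0) :
    ∃ f, G.regionCoboundary f = φ := by
  classical
  have := Fintype.ofFinite G.Region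
  have := Fintype.ofFinite G.Vertex
  have := Fintype.ofFinite G.Edge
  let M := LinearMap.toMatrix' G.vertexCoboundary
  have hM : ∀ ψ : G.Edge → ZMod 2, ψ ∈ LinearMap.ker M.transpose.mulVecLin ↔
      ∀ g : G.Vertex → ZMod 2, ∑ d, ψ (G.edgeOf d) * g (G.vertexOf d) = 0 := by
    intro ψ
    simp only [← G.sum_mul_vertexCoboundary]
    have key : ∀ g, ∑ e, ψ e * G.vertexCoboundary g e =
        dotProduct (M.transpose.mulVec ψ) g := by
      intro g
      have : G.vertexCoboundary g = M.mulVec g := by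
        rw [LinearMap.toMatrix'_mulVec]
      rw [this, Matrix.mulVec_transpose, ← Matrix.dotProduct_mulVec]
      rfl
    simp only [key, LinearMap.mem_ker, Matrix.mulVecLin_apply]
    exact dotProduct_eq_zero_iff.symm
  have hle : LinearMap.range G.regionCoboundary ≤ LinearMap.ker M.transpose.mulVecLin := by
    rintro _ ⟨f, rfl⟩
    exact (hM _).2 (G.sum_regionCoboundary_mul f)
  have h1 := M.transpose.mulVecLin.finrank_range_add_finrank_ker
  have h2 := G.vertexCoboundary.finrank_range_add_finrank_ker
  have h3 := G.regionCoboundary.finrank_range_add_finrank_ker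
  have h4 : Module.finrank (ZMod 2) (LinearMap.range M.transpose.mulVecLin) =
      Module.finrank (ZMod 2) (LinearMap.range G.vertexCoboundary) := by
    have : M.mulVecLin = G.vertexCoboundary := by
      rw [← Matrix.toLin'_apply', Matrix.toLin'_toMatrix']
    rw [← this]
    exact M.rank_transpose
  have h5 := G.finrank_ker_vertexCoboundary_le
  have h6 := hG.finrank_ker_regionCoboundary_le
  have h7 := hG.euler
  simp only [Module.finrank_fintype_fun_eq_card, ← Nat.card_eq_fintype_card] at h1 h2 h3
  -- The boundaries have dimension at least `R - 1` and the cycles at most `E - V + C`; Euler's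
  -- formula makes these numbers equal.
  have heq := Submodule.eq_of_le_of_finrank_le hle (by omega)
  have : φ ∈ LinearMap.range G.regionCoboundary := by
    rw [heq]
    exact (hM φ).2 hφ
  exact this

/-- A function on the edges whose values are differences of a function on the corners at each
vertex is a difference of a function on the regions. -/
theorem IsSpherical.exists_region_of_corner (hG : G.IsSpherical) (φ ψ : G.Dart → ZMod 2)
    (hopp : ∀ d, φ (G.opp d) = φ d) (hψ : ∀ d, φ d = ψ d + ψ (G.next d)) :
    ∃ f : G.Region → ZMod 2, ∀ d, φ d = f (G.region d) + f (G.region (G.opp d)) := by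
  have := Fintype.ofFinite G.Dart
  obtain ⟨f, hf⟩ := hG.exists_regionCoboundary_eq
    (Quot.lift φ (by rintro a _ rfl; exact (hopp a).symm)) (by
      intro g
      change ∑ d, φ d * g (G.vertexOf d) = 0
      simp only [hψ, add_mul, Finset.sum_add_distrib]
      have : ∑ d, ψ (G.next d) * g (G.vertexOf d) = ∑ d, ψ d * g (G.vertexOf d) := by
        rw [← Equiv.sum_comp G.next (fun d => ψ d * g (G.vertexOf d))]
        simp only [G.vertexOf_next]
      rw [this]
      exact CharTwo.add_self_eq_zero _)
  exact ⟨f, fun d => (congrFun hf (G.edgeOf d)).symm⟩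

/-- A loop on the sphere separates two different regions. -/
theorem IsSpherical.region_ne_of_loop (hG : G.IsSpherical) (d : G.Dart)
    (hd : G.vertexOf d = G.vertexOf (G.opp d)) : G.region d ≠ G.region (G.opp d) := by
  classical
  have := Fintype.ofFinite G.Dart
  -- A single edge is a mod 2 cycle because both its ends lie at one vertex.
  obtain ⟨f, hf⟩ := hG.exists_regionCoboundary_eq
    (fun e => if e = G.edgeOf d then 1 else 0) (by
      intro g
      simp only [ite_mul, one_mul, zero_mul]
      rw [← Finset.sum_filter, G.edge_sum (fun x => g (G.vertexOf x)), ← hd]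
      exact CharTwo.add_self_eq_zero _)
  intro h
  have := congrFun hf (G.edgeOf d)
  rw [regionCoboundary_edgeOf, ← h, CharTwo.add_self_eq_zero] at this
  simp at this

end SurfaceGraph

/-! ### Replacing crossings by bars, and the checkerboard colouring. -/

/-- A quotient is identified with a set of representatives. -/
def quotEquivOfSection {α β : Type*} {r : α → α → Prop} (f : α → β)
    (hf : ∀ a b, r a b → f a = f b) (g : β → α) (hfg : ∀ b, f (g b) = b)
    (hgf : ∀ a, Quot.mk r (g (f a)) = Quot.mk r a) : Quot r ≃ β where
  toFun := Quot.lift f hf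
  invFun b := Quot.mk r (g b)
  left_inv := by rintro ⟨a⟩; exact hgf a
  right_inv := hfg

theorem ZMod.four_cases (i : ZMod 4) : i = 0 ∨ i = 1 ∨ i = 2 ∨ i = 3 := by
  revert i; decide

namespace LinkDiagram

variable (D : LinkDiagram)

instance : Finite D.Crossing := D.finite_crossing
instance : Finite D.Circle := D.finite_circle

/-- The rotation at the two ends of the bar that replaces a crossing: the end `inr false` of the
bar lies in the corner between `1` and `2`, the end `inr true` in the one between `3` and `0`. -/
def barRotation : Equiv.Perm (ZMod 4 ⊕ Bool) where
  toFun := Sum.elim ![Sum.inr true, Sum.inl 2, Sum.inr false, Sum.inl 0]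
    (fun b => Sum.inl (cond b 3 1))
  invFun := Sum.elim ![Sum.inl 3, Sum.inr false, Sum.inl 1, Sum.inr true]
    (fun b => Sum.inl (cond b 0 2))
  left_inv := by
    rintro (i | b)
    · rcases i.four_cases with rfl | rfl | rfl | rfl <;> rfl
    · cases b <;> rfl
  right_inv := by
    rintro (i | b)
    · rcases i.four_cases with rfl | rfl | rfl | rfl <;> rfl
    · cases b <;> rfl

/-- The darts of the bar graph at the place of a crossing. -/
def barDart (c : D.Crossing) : ZMod 4 ⊕ Bool → D.shadow.Dart ⊕ (D.Crossing × Bool) :=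
  Sum.elim (fun i => Sum.inl (Sum.inl (c, i))) (fun b => Sum.inr (c, b))

/-- The cubic graph in which every crossing of the diagram is replaced by a bar that separates the
two undotted corners. -/
def barGraph : SurfaceGraph where
  Dart := D.shadow.Dart ⊕ (D.Crossing × Bool)
  Region := D.Region
  finite_dart := by
    have := D.shadow.finite_dart
    infer_instance
  finite_region := D.finite_region
  next :=
    { toFun := fun
        | Sum.inl (Sum.inl (c, i)) => D.barDart c (barRotation (Sum.inl i))
        | Sum.inl (Sum.inr (k, b)) => Sum.inl (Sum.inr (k, !b))
        | Sum.inr (c, b) => D.barDart c (barRotation (Sum.inr b))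
      invFun := fun
        | Sum.inl (Sum.inl (c, i)) => D.barDart c (barRotation.symm (Sum.inl i))
        | Sum.inl (Sum.inr (k, b)) => Sum.inl (Sum.inr (k, !b))
        | Sum.inr (c, b) => D.barDart c (barRotation.symm (Sum.inr b))
      left_inv := by
        rintro ((⟨c, i⟩ | ⟨k, b⟩) | ⟨c, b⟩)
        · rcases i.four_cases with rfl | rfl | rfl | rfl <;> rfl
        · cases b <;> rfl
        · cases b <;> rfl
      right_inv := by
        rintro ((⟨c, i⟩ | ⟨k, b⟩) | ⟨c, b⟩)
        · rcases i.four_cases with rfl | rfl | rfl | rfl <;> rfl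
        · cases b <;> rfl
        · cases b <;> rfl }
  opp := Sum.map D.shadow.opp (fun x => (x.1, !x.2))
  opp_opp := by
    rintro (x | ⟨c, b⟩)
    · simp [D.shadow.opp_opp]
    · simp
  opp_ne := by
    rintro (x | ⟨c, b⟩)
    · simpa using D.shadow.opp_ne x
    · simp
  region := Sum.elim D.shadow.region (fun x => D.corner (x.1, cond x.2 2 0))
  region_opp_next := by
    rintro ((⟨c, i⟩ | ⟨k, b⟩) | ⟨c, b⟩)
    · rcases i.four_cases with rfl | rfl | rfl | rfl
      · rfl
      · exact D.corner_arc c 1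
      · rfl
      · exact D.corner_arc c 3
    · exact D.shadow.region_opp_next (Sum.inr (k, b))
    · cases b
      · exact D.corner_arc c 0
      · exact D.corner_arc c 2

def shadowVertexEquiv : D.shadow.Vertex ≃ D.Crossing ⊕ D.Circle :=
  quotEquivOfSection (Sum.map Prod.fst Prod.fst)
    (by rintro (⟨c, i⟩ | ⟨k, b⟩) _ rfl <;> rfl)
    (Sum.map (fun c => (c, 0)) (fun k => (k, false)))
    (by rintro (c | k) <;> rfl)
    (by
      have step := D.shadow.vertexOf_next
      rintro (⟨c, i⟩ | ⟨k, b⟩)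
      · have h0 := step (Sum.inl (c, 0))
        have h1 := step (Sum.inl (c, 1))
        have h2 := step (Sum.inl (c, 2))
        rcases i.four_cases with rfl | rfl | rfl | rfl
        · rfl
        · exact h0.symm
        · exact (h1.trans h0).symm
        · exact (h2.trans (h1.trans h0)).symm
      · cases b
        · rfl
        · exact (step (Sum.inr (k, false))).symm)

def barVertexEquiv : D.barGraph.Vertex ≃ (D.Crossing × Bool) ⊕ D.Circle :=
  quotEquivOfSection
    (Sum.elim (Sum.map (fun x => (x.1, ![true, false, false, true] x.2)) Prod.fst) Sum.inl)
    (by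
      rintro ((⟨c, i⟩ | ⟨k, b⟩) | ⟨c, b⟩) _ rfl
      · rcases i.four_cases with rfl | rfl | rfl | rfl <;> rfl
      · rfl
      · cases b <;> rfl)
    (Sum.elim Sum.inr (fun k => Sum.inl (Sum.inr (k, false))))
    (by rintro (c | k) <;> rfl)
    (by
      have step := D.barGraph.vertexOf_next
      rintro ((⟨c, i⟩ | ⟨k, b⟩) | ⟨c, b⟩)
      · rcases i.four_cases with rfl | rfl | rfl | rfl
        · exact step (Sum.inl (Sum.inl (c, 0)))
        · exact (step (Sum.inr (c, false))).symm
        · exact step (Sum.inl (Sum.inl (c, 2)))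
        · exact (step (Sum.inr (c, true))).symm
      · cases b
        · rfl
        · exact (step (Sum.inl (Sum.inr (k, false)))).symm
      · rfl)

theorem componentOf_barDart (c : D.Crossing) (x y : ZMod 4 ⊕ Bool) :
    D.barGraph.componentOf (D.barDart c x) = D.barGraph.componentOf (D.barDart c y) := by
  have step := D.barGraph.componentOf_next
  have hb : D.barGraph.componentOf (Sum.inr (c, true)) =
      D.barGraph.componentOf (Sum.inr (c, false)) :=
    D.barGraph.componentOf_opp (Sum.inr (c, false))
  have h : ∀ x, D.barGraph.componentOf (D.barDart c x) =
      D.barGraph.componentOf (Sum.inr (c, false)) := by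
    rintro (i | b)
    · rcases i.four_cases with rfl | rfl | rfl | rfl
      · exact (step (Sum.inl (Sum.inl (c, 0)))).symm.trans hb
      · exact step (Sum.inr (c, false))
      · exact (step (Sum.inl (Sum.inl (c, 2)))).symm
      · exact (step (Sum.inr (c, true))).trans hb
    · cases b
      · rfl
      · exact hb
  rw [h, h]

theorem shadow_componentOf_eq (c : D.Crossing) (i j : ZMod 4) :
    D.shadow.componentOf (Sum.inl (c, i)) = D.shadow.componentOf (Sum.inl (c, j)) := by
  have step := D.shadow.componentOf_next
  have h0 := step (Sum.inl (c, 0))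
  have h1 := step (Sum.inl (c, 1))
  have h2 := step (Sum.inl (c, 2))
  have h : ∀ i, D.shadow.componentOf (Sum.inl (c, i)) = D.shadow.componentOf (Sum.inl (c, 0)) := by
    intro i
    rcases i.four_cases with rfl | rfl | rfl | rfl
    · rfl
    · exact h0
    · exact h1.trans h0
    · exact h2.trans (h1.trans h0)
  rw [h i, h j]

def barComponentEquiv : D.barGraph.Component ≃ D.shadow.Component where
  toFun := Quot.lift
    (Sum.elim D.shadow.componentOf (fun x => D.shadow.componentOf (Sum.inl (x.1, 0)))) (by
      rintro ((⟨c, i⟩ | ⟨k, b⟩) | ⟨c, b⟩) _ (rfl | rfl)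
      · rcases i.four_cases with rfl | rfl | rfl | rfl <;>
          exact D.shadow_componentOf_eq c _ _
      · exact (D.shadow.componentOf_opp (Sum.inl (c, i))).symm
      · exact (D.shadow.componentOf_next (Sum.inr (k, b))).symm
      · exact (D.shadow.componentOf_opp (Sum.inr (k, b))).symm
      · cases b <;> exact D.shadow_componentOf_eq c _ _
      · rfl)
  invFun := Quot.lift (fun d => D.barGraph.componentOf (Sum.inl d)) (by
    rintro (⟨c, i⟩ | ⟨k, b⟩) _ (rfl | rfl)
    · exact D.componentOf_barDart c (Sum.inl i) (Sum.inl (i + 1))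
    · exact (D.barGraph.componentOf_opp (Sum.inl (Sum.inl (c, i)))).symm
    · exact (D.barGraph.componentOf_next (Sum.inl (Sum.inr (k, b)))).symm
    · exact (D.barGraph.componentOf_opp (Sum.inl (Sum.inr (k, b)))).symm)
  left_inv := by
    rintro ⟨d | ⟨c, b⟩⟩
    · rfl
    · exact D.componentOf_barDart c (Sum.inl 0) (Sum.inr b)
  right_inv := by
    rintro ⟨d⟩
    rfl

variable {D}

/-- Each bar adds one vertex and one edge and keeps regions and components, so Euler's formula
survives. -/
theorem IsSpherical.barGraph (hD : D.IsSpherical) : D.barGraph.IsSpherical where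
  connected r s :=
    (hD.connected r s).mono fun _ _ ⟨d, h1, h2⟩ => ⟨Sum.inl d, h1, h2⟩
  euler := by
    have hv := Nat.card_congr D.shadowVertexEquiv
    have hv' := Nat.card_congr D.barVertexEquiv
    have hc := Nat.card_congr D.barComponentEquiv
    have he := D.shadow.card_dart
    have he' := D.barGraph.card_dart
    have hd : Nat.card D.barGraph.Dart = Nat.card D.shadow.Dart + Nat.card D.Crossing * 2 := by
      change Nat.card (D.shadow.Dart ⊕ (D.Crossing × Bool)) = _
      rw [Nat.card_sum, Nat.card_prod, Nat.card_eq_fintype_card (α := Bool), Fintype.card_bool]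
    rw [Nat.card_sum] at hv hv'
    rw [Nat.card_prod, Nat.card_eq_fintype_card (α := Bool), Fintype.card_bool] at hv'
    have h := hD.euler
    have hr : Nat.card D.barGraph.Region = Nat.card D.shadow.Region := rfl
    omega

/-- The two sides of an arc of a diagram in the sphere are different regions. -/
theorem IsSpherical.corner_ne_corner_arc (hD : D.IsSpherical) (x : D.Crossing × ZMod 4) :
    D.corner x ≠ D.corner (D.arc x) := by
  -- The set of all edges is a cycle: the vertices have degree four or two, so alternating corner
  -- values close up. The resulting `f` is a checkerboard colouring.
  obtain ⟨f, hf⟩ := SurfaceGraph.IsSpherical.exists_region_of_corner hD (fun _ => 1)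
    (Sum.elim (fun x => ![0, 1, 0, 1] x.2) (fun x => cond x.2 1 0)) (fun _ => rfl) (by
      rintro (⟨c, i⟩ | ⟨k, b⟩)
      · rcases i.four_cases with rfl | rfl | rfl | rfl <;> rfl
      · cases b <;> rfl)
  intro h
  have h1 : (1 : ZMod 2) = f (D.corner x) + f (D.corner (D.arc x)) := hf (Sum.inl x)
  rw [← h, CharTwo.add_self_eq_zero] at h1
  exact one_ne_zero h1

end LinkDiagram

/-! ### The medial diagram of a graph. -/

namespace SurfaceGraph

variable (G : SurfaceGraph)

/-- The ends of the medial diagram correspond to the pairs of a dart `d` and one of its sides,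
the left one (`false`) or the right one (`true`). This is the counterclockwise rotation of the ends
around the middle of an edge. -/
def medialRotate (x : G.Dart × Bool) : G.Dart × Bool :=
  cond x.2 (G.opp x.1, false) (x.1, true)

/-- The arcs of the medial diagram follow the corners of the graph. -/
def medialArc (x : G.Dart × Bool) : G.Dart × Bool :=
  cond x.2 (G.next.symm x.1, false) (G.next x.1, true)

/-- The regions of the medial diagram are the vertices and the regions of the graph. -/
def medialCorner (x : G.Dart × Bool) : G.Vertex ⊕ G.Region :=
  cond x.2 (Sum.inr (G.region (G.opp x.1))) (Sum.inl (G.vertexOf x.1))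

theorem medialArc_medialArc (x : G.Dart × Bool) : G.medialArc (G.medialArc x) = x := by
  obtain ⟨d, _ | _⟩ := x <;> simp [medialArc]

theorem medialArc_ne (x : G.Dart × Bool) : G.medialArc x ≠ x := by
  obtain ⟨d, _ | _⟩ := x <;> simp [medialArc]

theorem medialCorner_medialArc_medialRotate (x : G.Dart × Bool) :
    G.medialCorner (G.medialArc (G.medialRotate x)) = G.medialCorner x := by
  obtain ⟨d, _ | _⟩ := x
  · simp [medialArc, medialRotate, medialCorner, ← G.vertexOf_next (G.next.symm d)]
  · simp [medialArc, medialRotate, medialCorner, G.region_opp_next]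

open Classical in
/-- The first undotted end at the middle of an edge: the undotted corners belong to the two regions
along the edge, or to the two ends of the edge if these regions coincide. -/
noncomputable def medialStart (e : G.Edge) : G.Dart × Bool :=
  (Quot.out e, if G.region (Quot.out e) = G.region (G.opp (Quot.out e)) then false else true)

noncomputable def medialEndFun (x : G.Edge × ZMod 4) : G.Dart × Bool :=
  G.medialRotate^[x.2.val] (G.medialStart x.1)

theorem medialEndFun_add_one (e : G.Edge) (i : ZMod 4) :
    G.medialEndFun (e, i + 1) = G.medialRotate (G.medialEndFun (e, i)) := by
  rcases i.four_cases with rfl | rfl | rfl | rfl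
  · rfl
  · rfl
  · rfl
  · change G.medialStart e = G.medialRotate (G.medialRotate (G.medialRotate (G.medialRotate _)))
    obtain ⟨d, _ | _⟩ := G.medialStart e <;> simp [medialRotate, G.opp_opp]

/-- Four quarter turns visit both sides of both darts of an edge. The cases reflect that the
representative chosen by `Quot.out` may be either dart and that the start may be on either side. -/
theorem medialEndFun_surjective : Function.Surjective G.medialEndFun := by
  rintro ⟨d, b⟩
  suffices ∃ i, G.medialEndFun (G.edgeOf d, i) = (d, b) from this.imp' _ fun _ h => h
  have h : G.edgeOf d = G.edgeOf (G.medialStart (G.edgeOf d)).1 := (Quot.out_eq _).symm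
  have h0 : G.medialEndFun (G.edgeOf d, 0) = G.medialStart (G.edgeOf d) := rfl
  have h1 := G.medialEndFun_add_one (G.edgeOf d) 0
  have h2 := G.medialEndFun_add_one (G.edgeOf d) 1
  have h3 := G.medialEndFun_add_one (G.edgeOf d) 2
  rw [h0] at h1
  rw [zero_add] at h1
  rw [show (1 + 1 : ZMod 4) = 2 from rfl, h1] at h2
  rw [show (2 + 1 : ZMod 4) = 3 from rfl, h2] at h3
  rcases hx : G.medialStart (G.edgeOf d) with ⟨d', b'⟩
  rw [hx] at h h0 h1 h2 h3
  rcases G.edgeOf_eq_iff.1 h with rfl | h'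
  · cases b <;> cases b'
    · exact ⟨0, h0⟩
    · exact ⟨3, by rw [h3]; simp [medialRotate, G.opp_opp]⟩
    · exact ⟨1, h1⟩
    · exact ⟨0, h0⟩
  · simp only at h'
    subst h'
    cases b <;> cases b'
    · exact ⟨2, h2⟩
    · exact ⟨1, h1⟩
    · exact ⟨3, h3⟩
    · exact ⟨2, h2⟩

theorem medialEndFun_bijective : Function.Bijective G.medialEndFun := by
  have : Finite (ZMod 4) := inferInstanceAs (Finite (Fin 4))
  refine G.medialEndFun_surjective.bijective_of_nat_card_le ?_
  rw [Nat.card_prod, Nat.card_prod, G.card_dart, Nat.card_zmod,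
    Nat.card_eq_fintype_card (α := Bool), Fintype.card_bool]
  omega

noncomputable def medialEnd : G.Edge × ZMod 4 ≃ G.Dart × Bool :=
  Equiv.ofBijective _ G.medialEndFun_bijective

theorem medialEnd_add_one (e : G.Edge) (i : ZMod 4) :
    G.medialEnd (e, i + 1) = G.medialRotate (G.medialEnd (e, i)) :=
  G.medialEndFun_add_one e i

/-- The medial link diagram of a graph: the middles of the edges become crossings. -/
noncomputable def medial : LinkDiagram where
  Crossing := G.Edge
  Circle := Empty
  Region := G.Vertex ⊕ G.Region
  finite_crossing := inferInstance
  finite_circle := inferInstance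
  finite_region := inferInstance
  arc x := G.medialEnd.symm (G.medialArc (G.medialEnd x))
  arc_arc x := by simp [medialArc_medialArc]
  arc_ne x := by
    rw [ne_eq, Equiv.symm_apply_eq]
    exact G.medialArc_ne _
  corner x := G.medialCorner (G.medialEnd x)
  corner_arc c i := by
    rw [Equiv.apply_symm_apply, medialEnd_add_one, medialCorner_medialArc_medialRotate]
  side x := x.1.elim

/-- The pair is unordered because the chosen representative of the edge may be `d` or `G.opp d`. -/
theorem medial_corner_zero (d : G.Dart) (h : G.region d ≠ G.region (G.opp d)) :
    s(G.medial.corner (G.edgeOf d, 0), G.medial.corner (G.edgeOf d, 2)) =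
      s(Sum.inr (G.region d), Sum.inr (G.region (G.opp d))) := by
  have h0 : G.medial.corner (G.edgeOf d, 0) = G.medialCorner (G.medialStart (G.edgeOf d)) := rfl
  have h2 : G.medial.corner (G.edgeOf d, 2) =
    G.medialCorner (G.medialRotate (G.medialRotate (G.medialStart (G.edgeOf d)))) := rfl
  have he : G.edgeOf (Quot.out (G.edgeOf d)) = G.edgeOf d := Quot.out_eq _
  rw [h0, h2, medialStart]
  rcases G.edgeOf_eq_iff.1 he with h' | h' <;> rw [h']
  · simp only [h, medialRotate, medialCorner, G.opp_opp, if_false, cond]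
    exact Sym2.eq_swap
  · simp [h.symm, medialRotate, medialCorner, G.opp_opp]
    rfl

variable {G}

/-- If both sides of an edge are the same region, it is not a loop, since a loop separates; so its
end vertices, which are the undotted corners in that case, differ. -/
theorem IsSpherical.medial_isSemiReduced (hG : G.IsSpherical) : G.medial.IsSemiReduced := by
  intro (e : G.Edge)
  change G.medialCorner (G.medialStart e) ≠
    G.medialCorner (G.medialRotate (G.medialRotate (G.medialStart e)))
  unfold medialStart
  split_ifs with h
  · intro h'
    exact hG.region_ne_of_loop _ (Sum.inl_injective h') h
  · intro h'
    have h2 : G.region (G.opp (Quot.out e)) = G.region (G.opp (G.opp (Quot.out e))) :=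
      Sum.inr_injective h'
    rw [G.opp_opp] at h2
    exact h h2.symm

noncomputable def medialVertexEquiv : G.medial.shadow.Vertex ≃ G.Edge :=
  G.medial.shadowVertexEquiv.trans (Equiv.sumEmpty G.Edge Empty)

variable (G) in
/-- The component of the medial diagram through a given end. -/
noncomputable def medialComponentOf (x : G.Dart × Bool) : G.medial.shadow.Component :=
  G.medial.shadow.componentOf (Sum.inl (G.medialEnd.symm x))

theorem medialComponentOf_medialArc (x : G.Dart × Bool) :
    G.medialComponentOf (G.medialArc x) = G.medialComponentOf x := by
  have := G.medial.shadow.componentOf_opp (Sum.inl (G.medialEnd.symm x))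
  rw [medialComponentOf, medialComponentOf, ← this]
  change _ = G.medial.shadow.componentOf
    (Sum.inl (G.medialEnd.symm (G.medialArc (G.medialEnd (G.medialEnd.symm x)))))
  rw [Equiv.apply_symm_apply]

theorem medialComponentOf_medialRotate (x : G.Dart × Bool) :
    G.medialComponentOf (G.medialRotate x) = G.medialComponentOf x := by
  obtain ⟨⟨e, i⟩, rfl⟩ := G.medialEnd.surjective x
  rw [← medialEnd_add_one, medialComponentOf, medialComponentOf, Equiv.symm_apply_apply,
    Equiv.symm_apply_apply]
  exact G.medial.shadow_componentOf_eq e _ _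

theorem componentOf_medialArc (x : G.Dart × Bool) :
    G.componentOf (G.medialArc x).1 = G.componentOf x.1 := by
  obtain ⟨d, _ | _⟩ := x
  · exact G.componentOf_next d
  · simp [medialArc, ← G.componentOf_next (G.next.symm d)]

theorem componentOf_medialRotate (x : G.Dart × Bool) :
    G.componentOf (G.medialRotate x).1 = G.componentOf x.1 := by
  obtain ⟨d, _ | _⟩ := x
  · rfl
  · exact G.componentOf_opp d

noncomputable def medialComponentEquiv : G.medial.shadow.Component ≃ G.Component where
  toFun := Quot.lift
    (Sum.elim (fun x => G.componentOf (G.medialEnd x).1) (fun x => x.1.elim)) (by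
      rintro (⟨e, i⟩ | ⟨⟨⟩, _⟩) _ (rfl | rfl)
      · change G.componentOf (G.medialEnd (e, i)).1 = G.componentOf (G.medialEnd (e, i + 1)).1
        exact ((congrArg (fun x => G.componentOf x.1) (G.medialEnd_add_one e i)).trans
          (componentOf_medialRotate _)).symm
      · change _ = G.componentOf
          (G.medialEnd (G.medialEnd.symm (G.medialArc (G.medialEnd (e, i))))).1
        rw [Equiv.apply_symm_apply, componentOf_medialArc]
        rfl)
  invFun := Quot.lift (fun d => G.medialComponentOf (d, false)) (by
    rintro d _ (rfl | rfl)
    · exact (medialComponentOf_medialArc (d, false)).symm.trans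
        (medialComponentOf_medialRotate (G.next d, false))
    · exact (medialComponentOf_medialRotate (d, false)).symm.trans
        (medialComponentOf_medialRotate (d, true)).symm)
  left_inv := by
    rintro ⟨x | ⟨⟨⟩, _⟩⟩
    have h : G.medialComponentOf ((G.medialEnd x).1, false) =
        G.medialComponentOf (G.medialEnd x) := by
      obtain ⟨d, _ | _⟩ := G.medialEnd x
      · rfl
      · exact (medialComponentOf_medialRotate (d, false)).symm
    refine h.trans ?_
    exact congrArg (fun x => G.medial.shadow.componentOf (Sum.inl x))
      (G.medialEnd.symm_apply_apply x)
  right_inv := by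
    rintro ⟨d⟩
    change G.componentOf (G.medialEnd (G.medialEnd.symm (d, false))).1 = _
    rw [Equiv.apply_symm_apply]
    rfl

/-- The medial diagram has `E` vertices, `2E` edges, `V + R` regions and `C` components, so its
Euler formula is that of the graph. -/
theorem IsSpherical.medial (hG : G.IsSpherical) : G.medial.IsSpherical where
  connected := by
    let R : G.medial.Region → G.medial.Region → Prop :=
      Relation.EqvGen (fun a b => ∃ d, a = G.medial.shadow.region d ∧
        b = G.medial.shadow.region (G.medial.shadow.opp d))
    have hR : Equivalence R := Relation.EqvGen.is_equivalence _
    have h1 : ∀ d, R (Sum.inl (G.vertexOf d)) (Sum.inr (G.region d)) := by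
      intro d
      refine Relation.EqvGen.rel _ _ ⟨Sum.inl (G.medialEnd.symm (d, false)), ?_, ?_⟩
      · change _ = G.medialCorner (G.medialEnd (G.medialEnd.symm (d, false)))
        rw [Equiv.apply_symm_apply]
        rfl
      · change _ = G.medialCorner (G.medialEnd (G.medialEnd.symm
          (G.medialArc (G.medialEnd (G.medialEnd.symm (d, false))))))
        rw [Equiv.apply_symm_apply, Equiv.apply_symm_apply]
        exact congrArg Sum.inr (G.region_opp_next d).symm
    have h2 : ∀ d, R (Sum.inl (G.vertexOf d)) (Sum.inr (G.region (G.opp d))) := by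
      intro d
      have h := h1 (G.next.symm d)
      rw [← G.vertexOf_next, ← G.region_opp_next, Equiv.apply_symm_apply] at h
      exact h
    have h3 : ∀ r s : G.Region, R (Sum.inr r) (Sum.inr s) := by
      intro r s
      induction hG.connected r s with
      | rel r s h =>
        obtain ⟨d, rfl, rfl⟩ := h
        exact hR.trans (hR.symm (h1 d)) (h2 d)
      | refl => exact hR.refl _
      | symm _ _ _ ih => exact hR.symm ih
      | trans _ _ _ _ _ ih1 ih2 => exact hR.trans ih1 ih2
    have h4 : ∀ a : G.medial.Region, ∃ r : G.Region, R a (Sum.inr r) := by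
      rintro (v | r)
      · obtain ⟨d, rfl⟩ := Quot.exists_rep v
        exact ⟨_, h1 d⟩
      · exact ⟨r, hR.refl _⟩
    intro a b
    obtain ⟨r, hr⟩ := h4 a
    obtain ⟨s, hs⟩ := h4 b
    exact hR.trans hr (hR.trans (h3 r s) (hR.symm hs))
  euler := by
    have hv := Nat.card_congr (medialVertexEquiv (G := G))
    have hc := Nat.card_congr (medialComponentEquiv (G := G))
    have he := G.medial.shadow.card_dart
    have hd : Nat.card G.medial.shadow.Dart = Nat.card G.Edge * 4 := by
      change Nat.card ((G.Edge × ZMod 4) ⊕ (Empty × Bool)) = _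
      have : Finite (ZMod 4) := inferInstanceAs (Finite (Fin 4))
      rw [Nat.card_sum, Nat.card_prod, Nat.card_zmod, Nat.card_of_isEmpty (α := Empty × Bool),
        add_zero]
    have hr : Nat.card G.medial.shadow.Region = Nat.card G.Vertex + Nat.card G.Region :=
      Nat.card_sum
    have h := hG.euler
    omega

end SurfaceGraph

/-! ### Passing between coloured states and coloured regions. -/

namespace LinkDiagram

variable {D : LinkDiagram}

theorem componentOf_arc (S : D.State) (x : D.Crossing × ZMod 4) :
    D.componentOf S (D.arc x) = D.componentOf S x :=
  congrArg Sum.inl (Quot.sound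
    (r := fun x y : D.Crossing × ZMod 4 => y = D.arc x ∨ y = D.turn S x) (Or.inl rfl)).symm

theorem componentOf_turn (S : D.State) (x : D.Crossing × ZMod 4) :
    D.componentOf S (D.turn S x) = D.componentOf S x :=
  congrArg Sum.inl (Quot.sound
    (r := fun x y : D.Crossing × ZMod 4 => y = D.arc x ∨ y = D.turn S x) (Or.inr rfl)).symm

/-- A function with values in `ZMod 2` on the components of a state gives a set of regions, such
that crossing an arc means to leave or to enter the set if the value of the arc is `1`. -/
theorem IsSpherical.exists_region_of_state (hD : D.IsSpherical) (S : D.State)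
    (w : D.StateComponent S → ZMod 2) :
    ∃ f : D.Region → ZMod 2, ∀ x : D.Crossing × ZMod 4,
      w (D.componentOf S x) = f (D.corner x) + f (D.corner (D.arc x)) := by
  let φ : D.Crossing × ZMod 4 → ZMod 2 := fun x => w (D.componentOf S x)
  -- The state joins the four ends in two pairs of equal value, so their sum vanishes.
  have hsum : ∀ c, φ (c, 3) = φ (c, 0) + φ (c, 1) + φ (c, 2) := by
    intro c
    have hturn : ∀ x, φ (D.turn S x) = φ x := fun x => congrArg w (componentOf_turn S x)
    have h0 := hturn (c, 0)
    have h1 := hturn (c, 1)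
    have h2 := hturn (c, 2)
    by_cases hc : c ∈ S
    · simp only [turn, hc, if_true] at h0 h2
      change φ (c, 1) = φ (c, 0) at h0
      change φ (c, 3) = φ (c, 2) at h2
      rw [h0, h2, CharTwo.add_self_eq_zero, zero_add]
    · simp only [turn, hc, if_false] at h0 h1
      change φ (c, 2) = φ (c, 0) at h0
      change φ (c, 3) = φ (c, 1) at h1
      rw [h0, h1, add_comm (φ (c, 0)), add_assoc, CharTwo.add_self_eq_zero, add_zero]
  -- The corner values are partial sums around the crossing, and `hsum` closes them up. Circles may
  -- be given the value 0, as the conclusion concerns ends only.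
  obtain ⟨f, hf⟩ := SurfaceGraph.IsSpherical.exists_region_of_corner hD
    (Sum.elim φ (fun _ => 0))
    (Sum.elim (fun x => ![0, φ (x.1, 0), φ (x.1, 0) + φ (x.1, 1),
      φ (x.1, 0) + φ (x.1, 1) + φ (x.1, 2)] x.2) (fun _ => 0)) (by
      rintro (x | k)
      · exact congrArg w (componentOf_arc S x)
      · rfl) (by
      rintro (⟨c, i⟩ | k)
      · rcases i.four_cases with rfl | rfl | rfl | rfl
        · exact (zero_add _).symm
        · change φ (c, 1) = φ (c, 0) + (φ (c, 0) + φ (c, 1))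
          rw [← add_assoc, CharTwo.add_self_eq_zero, zero_add]
        · change φ (c, 2) = φ (c, 0) + φ (c, 1) + (φ (c, 0) + φ (c, 1) + φ (c, 2))
          rw [← add_assoc, CharTwo.add_self_eq_zero, zero_add]
        · exact (hsum c).trans (add_zero _).symm
      · rfl)
  exact ⟨f, fun x => hf (Sum.inl x)⟩

/-- A state with three colours gives a colouring of the regions with four colours that separates
the undotted corners at each crossing. -/
theorem IsSpherical.exists_region_coloring (hD : D.IsSpherical) {S : D.State}
    (hS : D.IsNColorable S 3) :
    ∃ f : D.Region → Fin 4, ∀ c, f (D.corner (c, 0)) ≠ f (D.corner (c, 2)) := by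
  obtain ⟨-, color, hcolor⟩ := hS
  -- The two indicators embed the three colors in `ZMod 2 × ZMod 2`. Injectivity suffices: if `f`
  -- and `g` both agree on the undotted corners, the ends 1 and 2, which lie on different arcs of
  -- the state, have equal color.
  obtain ⟨f, hf⟩ := hD.exists_region_of_state S (fun K => ![0, 0, 1] (color K))
  obtain ⟨g, hg⟩ := hD.exists_region_of_state S (fun K => ![0, 1, 0] (color K))
  have sum : ∀ (f : D.Region → ZMod 2) (w : D.StateComponent S → ZMod 2),
      (∀ x, w (D.componentOf S x) = f (D.corner x) + f (D.corner (D.arc x))) → ∀ c,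
      f (D.corner (c, 0)) = f (D.corner (c, 2)) →
      w (D.componentOf S (c, 1)) = w (D.componentOf S (c, 2)) := by
    intro f w hf c h
    rw [hf, hf]
    have h1 : D.corner (D.arc (c, 1)) = D.corner (c, 0) := D.corner_arc c 0
    have h2 : D.corner (D.arc (c, 2)) = D.corner (c, 1) := D.corner_arc c 1
    rw [h1, h2, h, add_comm]
  have hinj : ∀ a b : Fin 3, (![0, 0, 1] a : ZMod 2) = ![0, 0, 1] b →
      (![0, 1, 0] a : ZMod 2) = ![0, 1, 0] b → a = b := by decide
  have hinj' : ∀ a b a' b' : ZMod 2, finProdFinEquiv (m := 2) (n := 2) (a, b) =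
      finProdFinEquiv (m := 2) (n := 2) (a', b') → a = a' ∧ b = b' := by decide
  refine ⟨fun r => finProdFinEquiv (m := 2) (n := 2) (f r, g r), fun c h => ?_⟩
  obtain ⟨h1, h2⟩ := hinj' _ _ _ _ h
  refine hcolor (D.componentOf S (c, 1)) (D.componentOf S (c, 2)) ⟨c, 1, 2, ?_, ?_, rfl, rfl⟩
    (hinj _ _ (sum f (fun K => ![0, 0, 1] (color K)) hf c h1)
      (sum g (fun K => ![0, 1, 0] (color K)) hg c h2))
  · simp; decide
  · rw [turn]
    split_ifs
    · simp; decide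
    · simp; decide

/-- The colour of an arc between regions of given colours. -/
def arcColor (a b : Fin 4) : Fin 3 :=
  -- The three values are the three splittings of four colours into two pairs. The diagonal entries
  -- are placeholders, excluded by `harc` below.
  ![![0, 0, 1, 2], ![0, 0, 2, 1], ![1, 2, 0, 0], ![2, 1, 0, 0]] a b

theorem arcColor_comm (a b : Fin 4) : arcColor a b = arcColor b a := by
  revert a b; decide

/-- A colouring of the regions with four colours that separates the two sides of each arc and the
undotted corners at each crossing gives a state with three colours. -/
theorem exists_state_of_region_coloring (f : D.Region → Fin 4)
    (harc : ∀ x, f (D.corner x) ≠ f (D.corner (D.arc x)))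
    (hcorner : ∀ c, f (D.corner (c, 0)) ≠ f (D.corner (c, 2))) :
    ∃ S : D.State, D.IsNColorable S 3 := by
  let φ : D.Crossing × ZMod 4 → Fin 3 :=
    fun x => arcColor (f (D.corner x)) (f (D.corner (D.arc x)))
  have hφarc : ∀ x, φ (D.arc x) = φ x := by
    intro x
    simp only [φ, D.arc_arc]
    exact arcColor_comm _ _
  -- Smooth exactly where the smoothing respects the arc colours; `key` says that going straight
  -- does so at all other crossings, and that the two arcs at a crossing always differ in colour.
  let S : D.State := {c | φ (c, 0) = φ (c, 1)}
  have key : ∀ c, (φ (c, 0) = φ (c, 1) ∧ φ (c, 2) = φ (c, 3) ∧ φ (c, 1) ≠ φ (c, 2)) ∨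
      (φ (c, 0) ≠ φ (c, 1) ∧ φ (c, 0) = φ (c, 2) ∧ φ (c, 1) = φ (c, 3)) := by
    intro c
    have h0 : D.corner (D.arc (c, 0)) = D.corner (c, 3) := D.corner_arc c 3
    have h1 : D.corner (D.arc (c, 1)) = D.corner (c, 0) := D.corner_arc c 0
    have h2 : D.corner (D.arc (c, 2)) = D.corner (c, 1) := D.corner_arc c 1
    have h3 : D.corner (D.arc (c, 3)) = D.corner (c, 2) := D.corner_arc c 2
    have a0 := harc (c, 0)
    have a1 := harc (c, 1)
    have a2 := harc (c, 2)
    have a3 := harc (c, 3)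
    have a4 := hcorner c
    simp only [φ, h0, h1, h2, h3] at a0 a1 a2 a3 ⊢
    generalize f (D.corner (c, 0)) = b0 at *
    generalize f (D.corner (c, 1)) = b1 at *
    generalize f (D.corner (c, 2)) = b2 at *
    generalize f (D.corner (c, 3)) = b3 at *
    clear h0 h1 h2 h3 hφarc
    clear S φ
    revert b0 b1 b2 b3
    decide
  have hφturn : ∀ x, φ (D.turn S x) = φ x := by
    rintro ⟨c, i⟩
    rcases key c with ⟨h1, h2, h3⟩ | ⟨h1, h2, h3⟩
    · have hc : c ∈ S := h1
      simp only [turn, hc, if_true]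
      rcases i.four_cases with rfl | rfl | rfl | rfl
      exacts [h1.symm, h1, h2.symm, h2]
    · have hc : c ∉ S := h1
      simp only [turn, hc, if_false]
      rcases i.four_cases with rfl | rfl | rfl | rfl
      exacts [h2.symm, h3.symm, h2, h3]
  -- Circles meet no crossing, so their colour is arbitrary.
  let color : D.StateComponent S → Fin 3 := Sum.elim
    (Quot.lift φ (by
      rintro x _ (rfl | rfl)
      · exact (hφarc x).symm
      · exact (hφturn x).symm)) (fun _ => 0)
  have hcolor : D.IsColoring S 3 color := by
    rintro _ _ ⟨c, i, j, hne, hturn, rfl, rfl⟩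
    change φ (c, i) ≠ φ (c, j)
    rcases key c with ⟨h1, h2, h3⟩ | ⟨h1, h2, h3⟩
    · have hc : c ∈ S := h1
      simp only [turn, hc, if_true, ne_eq, Prod.mk.injEq, true_and] at hne hturn
      have h3' := h3.symm
      rcases i.four_cases with rfl | rfl | rfl | rfl <;>
        rcases j.four_cases with rfl | rfl | rfl | rfl <;>
        first
          | exact absurd rfl hne
          | exact absurd rfl hturn
          | simpa only [h1, ← h2] using h3
          | simpa only [h1, ← h2] using h3'
    · have hc : c ∉ S := h1
      simp only [turn, hc, if_false, ne_eq, Prod.mk.injEq, true_and] at hne hturn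
      have h1' := Ne.symm h1
      rcases i.four_cases with rfl | rfl | rfl | rfl <;>
        rcases j.four_cases with rfl | rfl | rfl | rfl <;>
        first
          | exact absurd rfl hne
          | exact absurd rfl hturn
          | simpa only [← h2, ← h3] using h1
          | simpa only [← h2, ← h3] using h1'
  exact ⟨S, fun K hK => hcolor K K hK rfl, color, hcolor⟩

end LinkDiagram

theorem mainTheorem2 :
    FourColorTheorem ↔
      ∀ D : LinkDiagram, D.IsSpherical → D.IsSemiReduced →
        ∃ S : D.State, D.IsNColorable S 3 := by
  constructor
  · intro h D hD hred
    obtain ⟨f, hf⟩ := h D.barGraph hD.barGraph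
    exact D.exists_state_of_region_coloring f
      (fun x => hf _ _ ⟨hD.corner_ne_corner_arc x, Sum.inl (Sum.inl x), rfl, rfl⟩)
      -- The bar is the common border edge of the undotted corners.
      (fun c => hf _ _ ⟨hred c, Sum.inr (c, false), rfl, rfl⟩)
  · intro h G hG
    obtain ⟨S, hS⟩ := h G.medial hG.medial hG.medial_isSemiReduced
    obtain ⟨f, hf⟩ := hG.medial.exists_region_coloring hS
    -- The colours of the medial regions around vertices are discarded.
    refine ⟨fun r => f (Sum.inr r), ?_⟩
    rintro _ _ ⟨hne, d, rfl, rfl⟩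
    rcases Sym2.eq_iff.1 (G.medial_corner_zero d hne) with ⟨h1, h2⟩ | ⟨h1, h2⟩
    · intro h
      exact hf (G.edgeOf d) ((congrArg f h1).trans (h.trans (congrArg f h2).symm))
    · intro h
      exact hf (G.edgeOf d) ((congrArg f h1).trans (h.symm.trans (congrArg f h2).symm))
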